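/- For an undirected graph $G$, an orientation of $G$ is a digraph obtained by choosing exactly one direction for every edge of $G$; it is strong if for all vertices $u,v$ it contains a directed path from $u$ to $v$. The diameter of a digraph is the supremum over all ordered pairs $(u,v)$ of the length of a shortest directed path from $u$ to $v$ (a value in $\mathbb{N}\cup\{\infty\}$), and $\mathrm{diam}_{\min}(G)$ is the minimum of $\mathrm{diam}(D)$ over all strong orientations $D$ of $G$. The strong product $G\boxtimes H$ has vertex set $V(G)\times V(H)$, and $(x_1,y_1)$, $(x_2,y_2)$ are adjacent if $x_1=x_2$ and $y_1y_2\in E(H)$, or $x_1x_2\in E(G)$ and $y_1=y_2$, or $x_1x_2\in E(G)$ and $y_1y_2\in E(H)$. Theorem. Let $T_1$ and $T_2$ be trees that both have at least two vertices, or both have exactly one vertex. Then $T_1\boxtimes T_2$ has a strong orientation, and $$\mathrm{diam}_{\min}(T_1\boxtimes T_2)\le \max\{\mathrm{diam}(T_1),\mathrm{diam}(T_2)\}+15 .$$ -/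

import Mathlib

namespace SimpleGraph

/-- The strong product of two simple graphs. -/
def strongProd {V W : Type*} (G : SimpleGraph V) (H : SimpleGraph W) : SimpleGraph (V × W) where
  Adj p q :=
    (p.1 = q.1 ∧ H.Adj p.2 q.2) ∨ (G.Adj p.1 q.1 ∧ p.2 = q.2) ∨ (G.Adj p.1 q.1 ∧ H.Adj p.2 q.2)
  symm := ⟨by
    rintro p q (⟨h₁, h₂⟩ | ⟨h₁, h₂⟩ | ⟨h₁, h₂⟩)
    · exact Or.inl ⟨h₁.symm, h₂.symm⟩
    · exact Or.inr (Or.inl ⟨h₁.symm, h₂.symm⟩)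
    · exact Or.inr (Or.inr ⟨h₁.symm, h₂.symm⟩)⟩
  loopless := ⟨by
    rintro p (⟨_, h⟩ | ⟨h, _⟩ | ⟨h, _⟩)
    · exact H.irrefl h
    · exact G.irrefl h
    · exact G.irrefl h⟩

end SimpleGraph

namespace Digraph

/-- There is a directed path of length `n` from `u` to `v`: pairwise distinct vertices
`p 0 = u, p 1, …, p n = v`, each with an arc to the next one. -/
def HasPath {V : Type*} (D : Digraph V) (u v : V) (n : ℕ) : Prop :=
  ∃ p : ℕ → V, p 0 = u ∧ p n = v ∧ (∀ i < n, D.Adj (p i) (p (i + 1))) ∧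
    Set.InjOn p (Set.Iic n)

/-- A digraph is strong if any vertex can be reached from any vertex by a directed path. -/
def IsStrong {V : Type*} (D : Digraph V) : Prop :=
  ∀ u v, ∃ n, D.HasPath u v n

/-- The distance from `u` to `v`: the length of a shortest directed path from `u` to `v`,
and `⊤` if there is none. -/
noncomputable def edist {V : Type*} (D : Digraph V) (u v : V) : ℕ∞ :=
  ⨅ (n : ℕ) (_ : D.HasPath u v n), (n : ℕ∞)

/-- The diameter of a digraph. -/
noncomputable def ediam {V : Type*} (D : Digraph V) : ℕ∞ :=
  ⨆ (u : V) (v : V), D.edist u v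

/-- `D` arises from the simple graph `G` by choosing exactly one direction for every edge. -/
structure IsOrientationOf {V : Type*} (D : Digraph V) (G : SimpleGraph V) : Prop where
  adj_iff : ∀ u v, G.Adj u v ↔ D.Adj u v ∨ D.Adj v u
  asymm : ∀ u v, D.Adj u v → ¬ D.Adj v u

end Digraph

/-- The minimum diameter of a strong orientation of `G` (`⊤` if there is no such orientation). -/
noncomputable def SimpleGraph.diamMin {V : Type*} (G : SimpleGraph V) : ℕ∞ :=
  sInf {d : ℕ∞ | ∃ D : Digraph V, D.IsOrientationOf G ∧ D.IsStrong ∧ D.ediam = d}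

/-! ### Walks and paths in digraphs -/

namespace Digraph

/-! Root both trees. A diagonal step flips both depth parities, so under `strongProdOrientation`
consecutive diagonals climb in the first tree while the parities agree and descend while they
differ. To get from `x` to `x'`, climb to a common ancestor of even depth, take one vertical step
there to make the parities differ, and descend (`exists_schedule_of_odd`). Every one of these steps
also moves the second coordinate along an edge of free choice, so only the number of such moves
matters: it has the right parity automatically (`Schedule.even_iff`), and a 4-step loop at the
ancestor (`schedule_wait`) makes it large enough. Adjusting the endpoints costs at most two steps
each. -/

/-- A directed walk of length `n` from `u` to `v`; vertices may be repeated. -/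
def HasWalk {V : Type*} (D : Digraph V) (u v : V) (n : ℕ) : Prop :=
  ∃ p : ℕ → V, p 0 = u ∧ p n = v ∧ ∀ i < n, D.Adj (p i) (p (i + 1))

variable {V : Type*} {D : Digraph V} {u v w : V} {n : ℕ}

theorem HasWalk.refl (u : V) : D.HasWalk u u 0 :=
  ⟨fun _ ↦ u, rfl, rfl, by simp⟩

theorem HasWalk.cons (h : D.Adj u v) (hw : D.HasWalk v w n) : D.HasWalk u w (n + 1) := by
  obtain ⟨p, h0, hn, hp⟩ := hw
  refine ⟨fun i ↦ Nat.casesOn i u p, rfl, hn, ?_⟩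
  rintro (_ | i) hi
  · simpa [h0] using h
  · exact hp i (by omega)

/-- A walk of minimal length is a path. -/
theorem HasWalk.exists_hasPath (hw : D.HasWalk u v n) : ∃ m ≤ n, D.HasPath u v m := by
  classical
  have hex : ∃ n, D.HasWalk u v n := ⟨n, hw⟩
  refine ⟨Nat.find hex, Nat.find_min' hex hw, ?_⟩
  obtain ⟨p, h0, hm, hp⟩ := Nat.find_spec hex
  refine ⟨p, h0, hm, hp, ?_⟩
  have key : ∀ i j, i < j → j ≤ Nat.find hex → p i ≠ p j := by
    intro i j hij hj he
    -- Cutting out the closed segment from `i` to `j` gives a shorter walk.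
    refine Nat.find_min hex (m := Nat.find hex - (j - i)) (by omega)
      ⟨fun k ↦ if k ≤ i then p k else p (k + (j - i)), by simpa using h0, ?_, ?_⟩
    · dsimp only
      split_ifs with h
      · have h₁ : Nat.find hex = j := by omega
        have h₂ : Nat.find hex - (j - i) = i := by omega
        rw [h₂, he, ← hm, h₁]
      · rw [Nat.sub_add_cancel (by omega), hm]
    · intro k hk
      dsimp only
      rcases lt_trichotomy k i with h | rfl | h
      · rw [if_pos h.le, if_pos (by omega : k + 1 ≤ i)]
        exact hp k (by omega)
      · rw [if_pos le_rfl, if_neg (by omega), he, show k + 1 + (j - k) = j + 1 by omega]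
        exact hp j (by omega)
      · rw [if_neg (by omega), if_neg (by omega), show k + 1 + (j - i) = k + (j - i) + 1 by omega]
        exact hp _ (by omega)
  intro i hi j hj he
  rcases lt_trichotomy i j with h | h | h
  · exact absurd he (key i j h hj)
  · exact h
  · exact absurd he.symm (key j i h hi)

theorem HasPath.edist_le (h : D.HasPath u v n) : D.edist u v ≤ n :=
  iInf₂_le n h

end Digraph

namespace SimpleGraph

/-! ### Rooted trees and common ancestors -/

section Rooted

variable {V : Type*} {G : SimpleGraph V} {r : V}

/-- `p` is the parent of `x` when `G` is rooted at `r`. -/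
def IsParent (G : SimpleGraph V) (r p x : V) : Prop :=
  G.Adj x p ∧ G.dist r p + 1 = G.dist r x

theorem IsTree.isParent_unique (hG : G.IsTree) {p q x : V} (hp : G.IsParent r p x)
    (hq : G.IsParent r q x) : p = q := by
  obtain ⟨P, hP⟩ := hG.connected.exists_walk_length_eq_dist r p
  obtain ⟨Q, hQ⟩ := hG.connected.exists_walk_length_eq_dist r q
  have h₁ := (P.concat hp.1.symm).isPath_of_length_eq_dist (by simp [hP, hp.2])
  have h₂ := (Q.concat hq.1.symm).isPath_of_length_eq_dist (by simp [hQ, hq.2])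
  have h := congrArg (fun W : G.Path r x ↦ W.1.penultimate)
    ((hG.isAcyclic.subsingleton_path r x).elim ⟨_, h₁⟩ ⟨_, h₂⟩)
  simpa using h

theorem IsTree.isParent_or_isParent (hG : G.IsTree) (r : V) {x y : V} (h : G.Adj x y) :
    G.IsParent r y x ∨ G.IsParent r x y := by
  rcases hG.dist_eq_dist_add_one_of_adj r h with h' | h'
  · exact .inl ⟨h, h'.symm⟩
  · exact .inr ⟨h.symm, h'.symm⟩

theorem Connected.exists_isParent (hG : G.Connected) {x : V} (hx : G.dist r x ≠ 0) :
    ∃ p, G.IsParent r p x := by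
  obtain ⟨P, hP⟩ := hG.exists_walk_length_eq_dist x r
  rw [dist_comm] at hP
  cases P with
  | nil => simp at hx
  | @cons _ p _ h P =>
    refine ⟨p, h, ?_⟩
    have h₁ := G.dist_le P
    have h₂ := h.diff_dist_adj (u := r)
    rw [dist_comm] at h₁
    simp only [Walk.length_cons] at hP
    omega

/-- `Ascends G r x m k`: the vertex `m` is reached from `x` by `k` steps to the parent. -/
inductive Ascends (G : SimpleGraph V) (r : V) : V → V → ℕ → Prop
  | refl (x : V) : Ascends G r x x 0
  | cons {x p m : V} {k : ℕ} : G.IsParent r p x → Ascends G r p m k → Ascends G r x m (k + 1)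

theorem Ascends.snoc {x m p : V} {k : ℕ} (h : G.Ascends r x m k) (hp : G.IsParent r p m) :
    G.Ascends r x p (k + 1) := by
  induction h with
  | refl x => exact .cons hp (.refl p)
  | cons hq _ ih => exact .cons hq (ih hp)

theorem Ascends.exists_isParent {x m : V} {k : ℕ} (h : G.Ascends r x m k) (hne : x ≠ m) :
    ∃ a, G.IsParent r m a := by
  induction h with
  | refl => exact absurd rfl hne
  | @cons x p m k hp _ ih =>
    by_cases h : p = m
    · exact ⟨x, h ▸ hp⟩
    · exact ih h

theorem IsTree.exists_ascends_of_walk (hG : G.IsTree) (r : V) {x y : V} (w : G.Walk x y) :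
    ∃ m k l, G.Ascends r x m k ∧ G.Ascends r y m l ∧ k + l ≤ w.length := by
  induction w with
  | nil => exact ⟨_, 0, 0, .refl _, .refl _, by simp⟩
  | @cons x z y h w ih =>
    obtain ⟨m, k, l, hk, hl, hle⟩ := ih
    simp only [Walk.length_cons]
    rcases hG.isParent_or_isParent r h with hp | hp
    · exact ⟨m, k + 1, l, .cons hp hk, hl, by omega⟩
    · cases hk with
      | refl => exact ⟨x, 0, l + 1, .refl _, hl.snoc hp, by omega⟩
      -- The ascent from `z` starts by returning to `x`, so this step is dropped.
      | @cons _ q _ k hq hk =>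
        obtain rfl := hG.isParent_unique hp hq
        exact ⟨m, k, l, hk, hl, by omega⟩

theorem IsTree.exists_ascends_even (hG : G.IsTree) (r x y : V) :
    ∃ m k l, G.Ascends r x m k ∧ G.Ascends r y m l ∧ Even (G.dist r m) ∧
      k + l ≤ G.dist x y + 2 := by
  obtain ⟨w, hw⟩ := hG.connected.exists_walk_length_eq_dist x y
  obtain ⟨m, k, l, hk, hl, hle⟩ := hG.exists_ascends_of_walk r w
  by_cases hm : Even (G.dist r m)
  · exact ⟨m, k, l, hk, hl, hm, by omega⟩
  · obtain ⟨p, hp⟩ := hG.connected.exists_isParent (r := r) (x := m) (by intro h; simp [h] at hm)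
    refine ⟨p, k + 1, l + 1, hk.snoc hp, hl.snoc hp, ?_, by omega⟩
    have := hp.2
    grind

theorem Connected.exists_adj [Nontrivial V] (hG : G.Connected) (x : V) : ∃ y, G.Adj x y := by
  obtain ⟨y, hy⟩ := exists_ne x
  obtain ⟨w⟩ := hG x y
  cases w with
  | nil => exact absurd rfl hy
  | cons h _ => exact ⟨_, h⟩

theorem Connected.exists_walk_length_eq [Nontrivial V] (hG : G.Connected) {x y : V} {n : ℕ}
    (hle : G.dist x y ≤ n) (hpar : Even n ↔ Even (G.dist x y)) :
    ∃ w : G.Walk x y, w.length = n := by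
  obtain ⟨z, hz⟩ := hG.exists_adj x
  have key : ∀ t, ∃ w : G.Walk x y, w.length = G.dist x y + 2 * t := by
    intro t
    induction t with
    | zero => simpa using hG.exists_walk_length_eq_dist x y
    | succ t ih =>
      obtain ⟨w, hw⟩ := ih
      exact ⟨.cons hz (.cons hz.symm w), by simp [hw]; ring⟩
  obtain ⟨w, hw⟩ := key ((n - G.dist x y) / 2)
  exact ⟨w, by grind⟩

theorem IsTree.even_walk_length_iff (hG : G.IsTree) (r : V) {x y : V} (w : G.Walk x y) :
    Even w.length ↔ (Even (G.dist r x) ↔ Even (G.dist r y)) := by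
  induction w with
  | nil => simp
  | cons h w ih =>
    rcases hG.dist_eq_dist_add_one_of_adj r h with h | h <;>
      simp only [Walk.length_cons, Nat.even_add_one, h, ih] <;> tauto

end Rooted

/-! ### The orientation and its schedules -/

section Orientation

variable {V W : Type*} {G : SimpleGraph V} {H : SimpleGraph W} {r : V} {s : W}

/-- The orientation of `G ⊠ H` in terms of the depths of the two coordinates. An edge in the
direction of `H` goes from even to odd depth, an edge in the direction of `G` leaves a vertex whose
coordinate depths have different parities, and a diagonal edge goes towards the root of `G` if its
coordinate depths have the same parity, and away from it otherwise. -/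
def strongProdOrientation (G : SimpleGraph V) (H : SimpleGraph W) (r : V) (s : W) :
    Digraph (V × W) where
  Adj a b :=
    (a.1 = b.1 ∧ H.Adj a.2 b.2 ∧ Even (H.dist s a.2)) ∨
    (G.Adj a.1 b.1 ∧ a.2 = b.2 ∧ (Even (G.dist r a.1) ↔ ¬ Even (H.dist s a.2))) ∨
    (G.Adj a.1 b.1 ∧ H.Adj a.2 b.2 ∧
      ((Even (G.dist r a.1) ↔ Even (H.dist s a.2)) ↔ G.dist r b.1 + 1 = G.dist r a.1))

theorem strongProdOrientation_isOrientationOf (hG : G.IsTree) (hH : H.IsTree) (r : V) (s : W) :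
    (strongProdOrientation G H r s).IsOrientationOf (G.strongProd H) where
  adj_iff := by
    rintro ⟨x, y⟩ ⟨x', y'⟩
    have hx := hG.dist_eq_dist_add_one_of_adj r (v := x) (w := x')
    have hy := hH.dist_eq_dist_add_one_of_adj s (v := y) (w := y')
    simp only [strongProd, strongProdOrientation, G.adj_comm x' x, H.adj_comm y' y]
    grind
  asymm := by
    rintro ⟨x, y⟩ ⟨x', y'⟩
    have hx := hG.dist_eq_dist_add_one_of_adj r (v := x) (w := x')
    have hy := hH.dist_eq_dist_add_one_of_adj s (v := y) (w := y')
    have h₁ := G.irrefl (v := x)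
    have h₂ := H.irrefl (v := y)
    simp only [strongProdOrientation, G.adj_comm x' x, H.adj_comm y' y]
    grind

/-- The projection to `G` of a walk in `strongProdOrientation`, together with the parity of the
depth of the second coordinate (`true` if it is even). In `Schedule G r x j x' j' n k`, the walk
has length `k`, and the second coordinate moves, along an arbitrary edge, in `n` of its steps. -/
inductive Schedule (G : SimpleGraph V) (r : V) : V → Bool → V → Bool → ℕ → ℕ → Prop
  | refl (x : V) (j : Bool) : Schedule G r x j x j 0 0
  | vert {x x' : V} {j' : Bool} {n k : ℕ} :
      Schedule G r x false x' j' n k → Schedule G r x true x' j' (n + 1) (k + 1)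
  | horiz {x z x' : V} {j j' : Bool} {n k : ℕ} : G.Adj x z → (Even (G.dist r x) ↔ j = false) →
      Schedule G r z j x' j' n k → Schedule G r x j x' j' n (k + 1)
  | diag {x z x' : V} {j j' : Bool} {n k : ℕ} : G.Adj x z →
      ((Even (G.dist r x) ↔ j = true) ↔ G.dist r z + 1 = G.dist r x) →
      Schedule G r z (!j) x' j' n k → Schedule G r x j x' j' (n + 1) (k + 1)

namespace Schedule

variable {x x' x'' : V} {j j' j'' : Bool} {n n' k k' : ℕ}

theorem trans (h : Schedule G r x j x' j' n k) (h' : Schedule G r x' j' x'' j'' n' k') :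
    Schedule G r x j x'' j'' (n + n') (k + k') := by
  induction h with
  | refl => simpa using h'
  | vert _ ih => rw [Nat.add_right_comm, Nat.add_right_comm _ 1]; exact .vert (ih h')
  | horiz ha hp _ ih => rw [Nat.add_right_comm _ 1]; exact .horiz ha hp (ih h')
  | diag ha hp _ ih =>
    rw [Nat.add_right_comm, Nat.add_right_comm _ 1]; exact .diag ha hp (ih h')

theorem even_iff (h : Schedule G r x j x' j' n k) : Even n ↔ j = j' := by
  induction h with
  | refl => simp
  | @vert _ _ j' _ _ _ ih => rw [Nat.even_add_one, ih]; cases j' <;> simp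
  | horiz _ _ _ ih => exact ih
  | @diag _ _ _ j j' _ _ _ _ _ ih => rw [Nat.even_add_one, ih]; cases j <;> cases j' <;> simp

/-- Every edge of a tree flips depth parity, so the recorded parity `j` stays correct whichever walk
is followed. -/
theorem hasWalk (hH : H.IsTree) (h : Schedule G r x j x' j' n k) {y y' : W} (w : H.Walk y y')
    (hw : w.length = n) (hy : Even (H.dist s y) ↔ j = true) :
    (strongProdOrientation G H r s).HasWalk (x, y) (x', y') k := by
  induction h generalizing y with
  | refl => obtain rfl := w.eq_of_length_eq_zero hw; exact .refl _
  | vert h ih =>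
    cases w with
    | nil => simp at hw
    | @cons _ z _ ha w =>
      have := hH.dist_eq_dist_add_one_of_adj s ha
      refine .cons (v := (_, z)) (.inl ⟨rfl, ha, by simpa using hy⟩)
        (ih w (by simpa using hw) (by grind))
  | horiz ha hp h ih =>
    refine .cons (v := (_, y)) (.inr (.inl ⟨ha, rfl, ?_⟩)) (ih w hw hy)
    simp only [hp, hy, Bool.not_eq_true]
  | diag ha hp h ih =>
    cases w with
    | nil => simp at hw
    | @cons _ z _ hb w =>
      have := hH.dist_eq_dist_add_one_of_adj s hb
      refine .cons (v := (_, z)) (.inr (.inr ⟨ha, hb, ?_⟩)) (ih w (by simpa using hw) (by grind))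
      simpa only [hy] using hp

end Schedule

theorem Ascends.schedule_up {x m : V} {k : ℕ} (h : G.Ascends r x m k) :
    Schedule G r x (decide (Even (G.dist r x))) m (decide (Even (G.dist r m))) k k := by
  induction h with
  | refl => exact .refl _ _
  | cons hp _ ih =>
    have h₁ := hp.2
    refine .diag hp.1 (by simp [h₁]) ?_
    convert ih using 1
    rw [← h₁]
    simp only [Nat.even_add_one, decide_not, Bool.not_not]

theorem Ascends.schedule_down {x m : V} {k : ℕ} (h : G.Ascends r x m k) :
    Schedule G r m (!decide (Even (G.dist r m))) x (!decide (Even (G.dist r x))) k k := by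
  induction h with
  | refl => exact .refl _ _
  | @cons x p m k hp _ ih =>
    have h₁ := hp.2
    refine ih.trans (.diag hp.1.symm ?_ ?_)
    · have : G.dist r x + 1 ≠ G.dist r p := by omega
      simp [this, -Nat.not_even_iff_odd]
    · convert Schedule.refl (G := G) (r := r) x _ using 1
      rw [← h₁]
      simp only [Nat.even_add_one, decide_not, Bool.not_not]

/-- The loop is vertical, down to the child `a`, vertical, back up to `m`; all four steps move the
second coordinate. -/
theorem IsParent.schedule_wait {m a : V} (ha : G.IsParent r m a)
    (hm : Even (G.dist r m)) (t : ℕ) :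
    Schedule G r m true m false (4 * t + 1) (4 * t + 1) := by
  have ha' : ¬ Even (G.dist r a) := by have := ha.2; grind
  induction t with
  | zero => exact .vert (.refl _ _)
  | succ t ih =>
    refine .vert (.diag ha.1.symm (z := a) ?_ (.vert (.diag ha.1 (z := m) ?_ ih)))
    · have := ha.2
      simp [hm]
      omega
    · simp [ha', ha.2]

theorem IsTree.exists_schedule_of_odd (hG : G.IsTree) {x x' : V} (hx : ¬ Even (G.dist r x))
    (hx' : ¬ Even (G.dist r x')) :
    ∃ c ≤ G.dist x x' + 3, ∀ t, Schedule G r x false x' true (c + 4 * t) (c + 4 * t) := by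
  obtain ⟨m, k, l, hk, hl, hm, hle⟩ := hG.exists_ascends_even r x x'
  have hup := hk.schedule_up
  have hdown := hl.schedule_down
  obtain ⟨a, ha⟩ := hk.exists_isParent (by rintro rfl; exact hx hm)
  refine ⟨k + l + 1, by omega, fun t ↦ ?_⟩
  simp only [hm, hx, hx', decide_true, decide_false, Bool.not_true, Bool.not_false] at hup hdown
  have := (hup.trans (ha.schedule_wait hm t)).trans hdown
  rwa [show k + (4 * t + 1) + l = k + l + 1 + 4 * t by ring] at this

theorem IsTree.exists_schedule_start [Nontrivial V] (hG : G.IsTree) (x : V) (j : Bool) :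
    ∃ x' n k, Schedule G r x j x' false n k ∧ ¬ Even (G.dist r x') ∧ k ≤ 2 ∧ k ≤ n + 1 ∧
      G.dist x x' ≤ 1 := by
  obtain ⟨z, hz⟩ := hG.connected.exists_adj x
  have hd := hG.dist_eq_dist_add_one_of_adj r hz
  have h1 : G.dist x z ≤ 1 := (dist_eq_one_iff_adj.2 hz).le
  by_cases hx : Even (G.dist r x)
  · have hz' : ¬ Even (G.dist r z) := by grind
    have hs : Schedule G r x false z false 0 1 := .horiz hz (by simp [hx]) (.refl _ _)
    cases j with
    | false => exact ⟨z, 0, 1, hs, hz', by simp, by simp, h1⟩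
    | true => exact ⟨z, 1, 2, .vert hs, hz', by simp, by simp, h1⟩
  · cases j with
    | false => exact ⟨x, 0, 0, .refl _ _, hx, by simp, by simp, by simp⟩
    | true => exact ⟨x, 1, 1, .vert (.refl _ _), hx, by simp, by simp, by simp⟩

theorem IsTree.exists_schedule_finish [Nontrivial V] (hG : G.IsTree) (x : V) (j : Bool) :
    ∃ x' n k, Schedule G r x' true x j n k ∧ ¬ Even (G.dist r x') ∧ k ≤ 2 ∧ k ≤ n + 1 ∧
      G.dist x' x ≤ 1 := by
  obtain ⟨z, hz⟩ := hG.connected.exists_adj x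
  have hd := hG.dist_eq_dist_add_one_of_adj r hz
  have h1 : G.dist z x ≤ 1 := (dist_eq_one_iff_adj.2 hz.symm).le
  by_cases hx : Even (G.dist r x)
  · have hz' : ¬ Even (G.dist r z) := by grind
    have hs : Schedule G r z true x true 0 1 := .horiz hz.symm (by simp [hz']) (.refl _ _)
    cases j with
    | true => exact ⟨z, 0, 1, hs, hz', by simp, by simp, h1⟩
    | false => exact ⟨z, 1, 2, hs.trans (.vert (.refl _ _)), hz', by simp, by simp, h1⟩
  · cases j with
    | true => exact ⟨x, 0, 0, .refl _ _, hx, by simp, by simp, by simp⟩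
    | false => exact ⟨x, 1, 1, .vert (.refl _ _), hx, by simp, by simp, by simp⟩

theorem IsTree.exists_schedule [Nontrivial V] (hG : G.IsTree) (x x' : V) (j j' : Bool) (d : ℕ) :
    ∃ n k, Schedule G r x j x' j' n k ∧ d ≤ n ∧ k ≤ max (G.dist x x') d + 9 := by
  obtain ⟨a, n₁, k₁, h₁, ha, hk₁, hn₁, hd₁⟩ := hG.exists_schedule_start (r := r) x j
  obtain ⟨b, n₂, k₂, h₂, hb, hk₂, hn₂, hd₂⟩ := hG.exists_schedule_finish (r := r) x' j'
  obtain ⟨c, hc, h⟩ := hG.exists_schedule_of_odd ha hb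
  have hab : G.dist a b ≤ G.dist x x' + 2 := by
    have t₁ := hG.connected.dist_triangle (u := a) (v := x) (w := b)
    have t₂ := hG.connected.dist_triangle (u := x) (v := x') (w := b)
    rw [dist_comm (u := a) (v := x)] at t₁
    rw [dist_comm (u := x') (v := b)] at t₂
    omega
  -- Just enough loops, rounded up. Without loops the length is at most `2 + (dist x x' + 5) + 2`;
  -- with loops it is at most `d + 3 + 2`.
  refine ⟨_, _, (h₁.trans (h ((d - (n₁ + c + n₂) + 3) / 4))).trans h₂, by omega, by omega⟩

theorem exists_hasPath_strongProdOrientation [Nontrivial V] [Nontrivial W] (hG : G.IsTree)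
    (hH : H.IsTree) (r : V) (s : W) (u v : V × W) :
    ∃ n ≤ max (G.dist u.1 v.1) (H.dist u.2 v.2) + 9,
      (strongProdOrientation G H r s).HasPath u v n := by
  obtain ⟨n, k, h, hn, hk⟩ := hG.exists_schedule (r := r) u.1 v.1 (decide (Even (H.dist s u.2)))
    (decide (Even (H.dist s v.2))) (H.dist u.2 v.2)
  obtain ⟨w₀, hw₀⟩ := hH.connected.exists_walk_length_eq_dist u.2 v.2
  obtain ⟨w, hw⟩ := hH.connected.exists_walk_length_eq hn <| by
    rw [h.even_iff, ← hw₀, hH.even_walk_length_iff s, decide_eq_decide]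
  obtain ⟨m, hm, hp⟩ := (h.hasWalk (s := s) hH w hw (by simp)).exists_hasPath
  exact ⟨m, hm.trans hk, hp⟩

theorem diamMin_le {G : SimpleGraph V} {D : Digraph V} (hD : D.IsOrientationOf G)
    (hs : D.IsStrong) : G.diamMin ≤ D.ediam :=
  sInf_le ⟨D, hD, hs, rfl⟩

end Orientation

end SimpleGraph

/-! ### The diameter bound -/

open SimpleGraph in
theorem theorem1 {V₁ V₂ : Type*} (T₁ : SimpleGraph V₁) (T₂ : SimpleGraph V₂)
    (hT₁ : T₁.IsTree) (hT₂ : T₂.IsTree) (hV : Nontrivial V₁ ↔ Nontrivial V₂) :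
    (∃ D : Digraph (V₁ × V₂), D.IsOrientationOf (T₁.strongProd T₂) ∧ D.IsStrong) ∧
      (T₁.strongProd T₂).diamMin ≤ max T₁.ediam T₂.ediam + 15 := by
  obtain ⟨r⟩ := hT₁.connected.nonempty
  obtain ⟨s⟩ := hT₂.connected.nonempty
  set D := strongProdOrientation T₁ T₂ r s
  have hD : D.IsOrientationOf (T₁.strongProd T₂) :=
    strongProdOrientation_isOrientationOf hT₁ hT₂ r s
  have key : ∀ u v, ∃ n ≤ max (T₁.dist u.1 v.1) (T₂.dist u.2 v.2) + 9, D.HasPath u v n := by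
    intro u v
    rcases subsingleton_or_nontrivial V₁ with h₁ | h₁
    · have h₂ : Subsingleton V₂ := by
        rwa [← not_nontrivial_iff_subsingleton, ← hV, not_nontrivial_iff_subsingleton]
      obtain rfl := Subsingleton.elim u v
      obtain ⟨m, hm, hp⟩ := (Digraph.HasWalk.refl (D := D) u).exists_hasPath
      exact ⟨m, by omega, hp⟩
    · have h₂ := hV.1 h₁
      exact exists_hasPath_strongProdOrientation hT₁ hT₂ r s u v
  have hs : D.IsStrong := fun u v ↦ let ⟨n, _, h⟩ := key u v; ⟨n, h⟩
  refine ⟨⟨D, hD, hs⟩, (diamMin_le hD hs).trans (iSup₂_le fun u v ↦ ?_)⟩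
  obtain ⟨n, hn, hp⟩ := key u v
  calc D.edist u v ≤ n := hp.edist_le
    _ ≤ ((max (T₁.dist u.1 v.1) (T₂.dist u.2 v.2) + 9 : ℕ) : ℕ∞) := by exact_mod_cast hn
    _ = max (T₁.edist u.1 v.1) (T₂.edist u.2 v.2) + 9 := by
      rw [← (hT₁.connected u.1 v.1).coe_dist_eq_edist, ← (hT₂.connected u.2 v.2).coe_dist_eq_edist]
      push_cast
      rfl
    _ ≤ max T₁.ediam T₂.ediam + 15 := by
      gcongr
      · exact edist_le_ediam
      · exact edist_le_ediam
      -- The construction gives 9, so the constant 15 has slack.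
      · norm_num
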